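/- Let $D$ be an integral domain with quotient field $K$. For a multiplicative set $W$ of nonzero finitely generated ideals of $D$ with $D\in W$ and an ideal $Q$ of $D$, put $Q_W=\bigcup\{(Q:H)\mid H\in W\}$, where $(Q:H)=\{x\in D\mid xH\subseteq Q\}$. Call $Q$ a $W$-ideal if $Q=Q_W$; call a $W$-ideal $Q$ a $W$-cancellation ideal if $(QJ)_W=(QN)_W$ with $J,N$ ideals of $D$ implies $J_W=N_W$; a maximal $W$-ideal is a maximal element, with respect to inclusion, of the set of $W$-ideals different from $D$ (such an ideal is prime). (1) Let $W$ be the set of nonzero finitely generated ideals $H$ of $D$ with $H^{-1}=D$, where $H^{-1}=\{x\in K\mid xH\subseteq D\}$; in this case one writes $w$ in place of $W$. A nonzero $w$-ideal $Q$ of $D$ is a $w$-cancellation ideal if and only if $QD_M$ is principal for each maximal $w$-ideal $M$ of $D$. (2) More generally, let $*$ be a star operation on $D$, i.e. a map $I\mapsto I^*$ on the nonzero fractional ideals of $D$ such that $(aD)^*=aD$, $(aI)^*=aI^*$, $I\subseteq I^*$, $I\subseteq J$ implies $I^*\subseteq J^*$, and $(I^*)^*=I^*$, for all nonzero $a\in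 K$ and all nonzero fractional ideals $I,J$. Let $W$ be the set of nonzero finitely generated ideals $H$ of $D$ with $H^*=D$; in this case one writes $*_w$ in place of $W$. A nonzero $*_w$-ideal $Q$ of $D$ is a $*_w$-cancellation ideal if and only if $QD_M$ is principal for each maximal $*_w$-ideal $M$ of $D$. -/

import Mathlib

open scoped nonZeroDivisors

namespace StarIdeal

section Closure

variable {D : Type*} [CommRing D]

/-- For a multiplicative set `W` of ideals, the closure `Q_W = ⋃ {(Q : H) | H ∈ W}` of an
ideal `Q`. The union is an ideal because `W` is closed under products. -/
def idealClosure (W : Submonoid (Ideal D)) (Q : Ideal D) : Ideal D where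
  carrier := {x | ∃ H ∈ W, x ∈ Q.colon (H : Set D)}
  zero_mem' := ⟨1, W.one_mem, zero_mem _⟩
  add_mem' := by
    rintro x y ⟨H, hH, hx⟩ ⟨H', hH', hy⟩
    refine ⟨H * H', W.mul_mem hH hH', add_mem ?_ ?_⟩
    · exact Submodule.mem_colon.2 fun z hz => Submodule.mem_colon.1 hx z (Ideal.mul_le_left hz)
    · exact Submodule.mem_colon.2 fun z hz => Submodule.mem_colon.1 hy z (Ideal.mul_le_right hz)
  smul_mem' := by
    rintro c x ⟨H, hH, hx⟩
    exact ⟨H, hH, Submodule.smul_mem _ c hx⟩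

/-- `Q` is a `W`-ideal: `Q = Q_W`. -/
def IsClosedIdeal (W : Submonoid (Ideal D)) (Q : Ideal D) : Prop :=
  Q = idealClosure W Q

/-- `Q` is a `W`-cancellation ideal: `Q` is a `W`-ideal, and `(QJ)_W = (QN)_W` with ideals
`J`, `N` implies `J_W = N_W`. -/
def IsCancellationIdeal (W : Submonoid (Ideal D)) (Q : Ideal D) : Prop :=
  IsClosedIdeal W Q ∧
    ∀ J N : Ideal D, idealClosure W (Q * J) = idealClosure W (Q * N) →
      idealClosure W J = idealClosure W N

/-- `M` is a maximal `W`-ideal: maximal, for inclusion, among the `W`-ideals other than `D`. -/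
def IsMaximalClosedIdeal (W : Submonoid (Ideal D)) (M : Ideal D) : Prop :=
  Maximal (fun I : Ideal D => IsClosedIdeal W I ∧ I ≠ ⊤) M

theorem mem_idealClosure {W : Submonoid (Ideal D)} {Q : Ideal D} {x : D} :
    x ∈ idealClosure W Q ↔ ∃ H ∈ W, ∀ h ∈ H, x * h ∈ Q := by
  change (∃ H ∈ W, x ∈ Q.colon (H : Set D)) ↔ _
  simp [Submodule.mem_colon]

theorem le_idealClosure (W : Submonoid (Ideal D)) (Q : Ideal D) : Q ≤ idealClosure W Q := fun _ hx =>
  mem_idealClosure.2 ⟨1, W.one_mem, fun h _ => Q.mul_mem_right h hx⟩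

theorem idealClosure_idealClosure {W : Submonoid (Ideal D)} (hW : ∀ H ∈ W, H.FG) (Q : Ideal D) :
    idealClosure W (idealClosure W Q) = idealClosure W Q := by
  classical
  refine le_antisymm (fun x hx => ?_) (le_idealClosure _ _)
  obtain ⟨H, hH, hx⟩ := mem_idealClosure.1 hx
  obtain ⟨s, hs⟩ := hW H hH
  have key : ∀ t : Finset D, t ⊆ s → ∃ G ∈ W, ∀ h ∈ t, ∀ g ∈ G, x * h * g ∈ Q := by
    intro t
    induction t using Finset.induction_on with
    | empty => exact fun _ => ⟨1, W.one_mem, by simp⟩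
    | insert a t _ ih =>
      intro hst
      obtain ⟨G, hG, h1⟩ := ih fun z hz => hst (Finset.mem_insert_of_mem hz)
      obtain ⟨G', hG', h2⟩ := mem_idealClosure.1
        (hx a (hs ▸ Ideal.subset_span (hst (Finset.mem_insert_self a t))))
      refine ⟨G * G', W.mul_mem hG hG', fun h hh g hg => ?_⟩
      rcases Finset.mem_insert.1 hh with rfl | hh
      · exact h2 g (Ideal.mul_le_right hg)
      · exact h1 h hh g (Ideal.mul_le_left hg)
  obtain ⟨G, hG, h1⟩ := key s subset_rfl
  refine mem_idealClosure.2 ⟨H * G, W.mul_mem hH hG, fun z hz => ?_⟩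
  refine Submodule.mul_induction_on hz (fun h hh g hg => ?_) (fun a b ha hb => ?_)
  · have : H ≤ Q.colon {x * g} := by
      rw [← hs, Ideal.span_le]
      intro k hk
      rw [SetLike.mem_coe, Submodule.mem_colon_singleton, smul_eq_mul]
      have := h1 k hk g hg
      rwa [show k * (x * g) = x * k * g by ring]
    have h3 := Submodule.mem_colon_singleton.1 (this hh)
    rwa [smul_eq_mul, show h * (x * g) = x * (h * g) by ring] at h3
  · rw [mul_add]
    exact Q.add_mem ha hb

/-- Maximal `W`-ideals are prime, so that one can localize at them. -/
theorem IsMaximalClosedIdeal.isPrime {W : Submonoid (Ideal D)} {M : Ideal D}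
    (hM : IsMaximalClosedIdeal W M) (hW : ∀ H ∈ W, H.FG) : M.IsPrime := by
  have key : ∀ a, a ∉ M → ∃ H ∈ W, H ≤ M ⊔ Ideal.span {a} := by
    intro a ha
    have htop : idealClosure W (M ⊔ Ideal.span {a}) = ⊤ := by
      by_contra hne
      have h1 := hM.2 ⟨(idealClosure_idealClosure hW _).symm, hne⟩ (le_sup_left.trans (le_idealClosure _ _))
      exact ha (h1 (le_idealClosure _ _
        (Ideal.mem_sup_right (Ideal.subset_span (Set.mem_singleton a)))))
    obtain ⟨H, hH, h1⟩ := mem_idealClosure.1 ((Ideal.eq_top_iff_one _).1 htop)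
    exact ⟨H, hH, fun h hh => by simpa using h1 h hh⟩
  refine ⟨hM.1.2, fun {a b} hab => ?_⟩
  by_contra! hcon
  obtain ⟨H, hH, h1⟩ := key a hcon.1
  obtain ⟨G, hG, h2⟩ := key b hcon.2
  have hle : H * G ≤ M := by
    refine (Ideal.mul_mono h1 h2).trans ?_
    rw [Ideal.sup_mul, Ideal.mul_sup, Ideal.mul_sup]
    refine sup_le (sup_le ?_ ?_) (sup_le ?_ ?_)
    · exact Ideal.mul_le.2 fun x hx y _ => M.mul_mem_right y hx
    · exact Ideal.mul_le.2 fun x hx y _ => M.mul_mem_right y hx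
    · exact Ideal.mul_le.2 fun x _ y hy => M.mul_mem_left x hy
    · rw [Ideal.span_singleton_mul_span_singleton]
      exact (Ideal.span_singleton_le_iff_mem _).2 hab
  refine hM.1.2 ((Ideal.eq_top_iff_one _).2 ?_)
  rw [hM.1.1]
  exact mem_idealClosure.2 ⟨H * G, W.mul_mem hH hG, fun h hh => by rw [one_mul]; exact hle hh⟩

end Closure

section Domain

variable (D K : Type*) [CommRing D] [IsDomain D] [Field K] [Algebra D K] [IsFractionRing D K]

/-- The set `W` of nonzero finitely generated ideals `H` of `D` with `H⁻¹ = D`, where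
`H⁻¹ = {x ∈ K | xH ⊆ D}`. It is closed under products. The `w`-operation is the closure
with respect to this set. -/
def wFamily : Submonoid (Ideal D) where
  carrier := {H | H ≠ ⊥ ∧ H.FG ∧ (H : FractionalIdeal D⁰ K)⁻¹ = 1}
  one_mem' := ⟨one_ne_zero, ⟨{1}, by simp⟩, by simp⟩
  mul_mem' := by
    rintro H G ⟨hH0, hHf, hH⟩ ⟨hG0, hGf, hG⟩
    have hH0' : (H : FractionalIdeal D⁰ K) ≠ 0 := FractionalIdeal.coeIdeal_ne_zero.2 hH0
    have hG0' : (G : FractionalIdeal D⁰ K) ≠ 0 := FractionalIdeal.coeIdeal_ne_zero.2 hG0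
    refine ⟨mul_ne_zero hH0 hG0, hHf.mul hGf, ?_⟩
    have h0 : (H : FractionalIdeal D⁰ K) * G ≠ 0 := by
      rw [← FractionalIdeal.coeIdeal_mul]
      exact FractionalIdeal.coeIdeal_ne_zero.2 (mul_ne_zero hH0 hG0)
    rw [FractionalIdeal.inv_eq] at hH hG ⊢
    rw [FractionalIdeal.coeIdeal_mul]
    refine eq_of_forall_le_iff fun X => ?_
    rw [FractionalIdeal.le_div_iff_mul_le h0, ← mul_assoc,
      ← FractionalIdeal.le_div_iff_mul_le hG0', hG,
      ← FractionalIdeal.le_div_iff_mul_le hH0', hH]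

/-- A star operation on `D`: a map `I ↦ I^*` on the nonzero fractional ideals of `D` with
`(aD)^* = aD`, `(aI)^* = a I^*` for `0 ≠ a ∈ K`, `I ⊆ I^*`, `I ⊆ J → I^* ⊆ J^*` and
`(I^*)^* = I^*`. The value at the zero ideal is immaterial. -/
structure StarOperation where
  star : FractionalIdeal D⁰ K → FractionalIdeal D⁰ K
  star_principal : ∀ a : K, a ≠ 0 →
    star (FractionalIdeal.spanSingleton D⁰ a) = FractionalIdeal.spanSingleton D⁰ a
  star_smul : ∀ (a : K) (I : FractionalIdeal D⁰ K), a ≠ 0 → I ≠ 0 →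
    star (FractionalIdeal.spanSingleton D⁰ a * I) = FractionalIdeal.spanSingleton D⁰ a * star I
  le_star : ∀ I : FractionalIdeal D⁰ K, I ≠ 0 → I ≤ star I
  star_mono : ∀ I J : FractionalIdeal D⁰ K, I ≠ 0 → J ≠ 0 → I ≤ J → star I ≤ star J
  star_star : ∀ I : FractionalIdeal D⁰ K, I ≠ 0 → star (star I) = star I

variable {D K}

/-- The set of nonzero finitely generated ideals `H` of `D` with `H^* = D`. It is closed under
products. For an ideal `Q` of `D` the closure of `Q` with respect to this set is
`Q_{*_w} = {x ∈ K | xH ⊆ Q for some H in the set}`: such an `x` lies in `D`, since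
`xH ⊆ D` gives `xD = (xH)^* ⊆ D`. -/
def StarOperation.wFamily (s : StarOperation D K) : Submonoid (Ideal D) where
  carrier := {H | H ≠ ⊥ ∧ H.FG ∧ s.star (H : FractionalIdeal D⁰ K) = 1}
  one_mem' := by
    refine ⟨one_ne_zero, ⟨{1}, by simp⟩, ?_⟩
    have := s.star_principal 1 one_ne_zero
    simpa using this
  mul_mem' := by
    rintro H G ⟨hH0, hHf, hH⟩ ⟨hG0, hGf, hG⟩
    have hH0' : (H : FractionalIdeal D⁰ K) ≠ 0 := FractionalIdeal.coeIdeal_ne_zero.2 hH0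
    have hG0' : (G : FractionalIdeal D⁰ K) ≠ 0 := FractionalIdeal.coeIdeal_ne_zero.2 hG0
    have h0 : (H : FractionalIdeal D⁰ K) * G ≠ 0 := by
      rw [← FractionalIdeal.coeIdeal_mul]
      exact FractionalIdeal.coeIdeal_ne_zero.2 (mul_ne_zero hH0 hG0)
    have hs0 : s.star ((H : FractionalIdeal D⁰ K) * G) ≠ 0 := fun h =>
      h0 (le_antisymm (h ▸ s.le_star _ h0) (FractionalIdeal.zero_le _))
    have h1 : s.star (1 : FractionalIdeal D⁰ K) = 1 := by
      have := s.star_principal 1 one_ne_zero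
      simpa using this
    refine ⟨mul_ne_zero hH0 hG0, hHf.mul hGf, ?_⟩
    rw [FractionalIdeal.coeIdeal_mul]
    refine le_antisymm ?_ ?_
    · rw [← h1]
      refine s.star_mono _ _ h0 one_ne_zero ?_
      rw [← FractionalIdeal.coeIdeal_mul]
      exact FractionalIdeal.coeIdeal_le_one
    · have hle : (G : FractionalIdeal D⁰ K) ≤ s.star ((H : FractionalIdeal D⁰ K) * G) := by
        intro g hg
        by_cases hg0 : g = 0
        · rw [hg0]; exact FractionalIdeal.zero_mem _
        have h2 : FractionalIdeal.spanSingleton D⁰ g ≤ (G : FractionalIdeal D⁰ K) :=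
          FractionalIdeal.spanSingleton_le_iff_mem.2 hg
        have hgH : FractionalIdeal.spanSingleton D⁰ g * (H : FractionalIdeal D⁰ K) ≠ 0 := by
          intro h
          apply hH0'
          rw [← one_mul (H : FractionalIdeal D⁰ K), ← FractionalIdeal.spanSingleton_one,
            ← inv_mul_cancel₀ hg0, ← FractionalIdeal.spanSingleton_mul_spanSingleton,
            mul_assoc, h, mul_zero]
        have h3 := s.star_mono (FractionalIdeal.spanSingleton D⁰ g * H) (H * G)
          hgH h0
          (by rw [mul_comm (H : FractionalIdeal D⁰ K)]; gcongr)
        rw [s.star_smul g _ hg0 hH0', hH, mul_one] at h3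
        exact FractionalIdeal.spanSingleton_le_iff_mem.1 h3
      have h4 := s.star_mono _ _ hG0' hs0 hle
      rwa [hG, s.star_star _ h0] at h4

theorem fg_of_mem_wFamily : ∀ H ∈ wFamily D K, H.FG := fun _ hH => hH.2.1

theorem StarOperation.fg_of_mem_wFamily (s : StarOperation D K) : ∀ H ∈ s.wFamily, H.FG :=
  fun _ hH => hH.2.1

end Domain

end StarIdeal

/-! ### Squares of elements in cancellation ideals. -/

namespace Ideal

variable {R : Type*} [CommRing R]

/-! Both equivalences use only that `W` is multiplicative with finitely generated members. Then
every proper `W`-ideal lies in a maximal one, and `J_W` is the intersection of `D` with the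
localizations of `J` at the maximal `W`-ideals (`mem_idealClosure_iff_forall_maximal`). If `Q` is
principal at each of these, with nonzero generator since `D` is a domain, it can be cancelled
locally, hence up to closure.

Conversely, a `W`-cancellation ideal localizes to a cancellation ideal of the local ring `D_M`
(`localization_cancel`), and such an ideal `I` is principal (`isPrincipal_of_cancel`), even if not
known to be finitely generated. For the latter, `I ≠ 𝔪I`. If `x`, `y ∈ I` were independent modulo
`𝔪I`, a complement `A` would give `I = (x, y) + A`; cancelling `I` in `I³ ⊆ I(x² + y², xy, IA)`
gives a relation for `x²` that makes `x` or `y` redundant. So `I = (x) + 𝔪I`, and one more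
cancellation replaces Nakayama's lemma. -/

theorem mem_of_sq_mem_mul {I K : Ideal R} (hI : ∀ J N : Ideal R, I * J ≤ I * N → J ≤ N) {p : R}
    (hp : p ∈ I) (hrep : ∀ u ∈ I, ∃ c, ∃ k ∈ K, u = c * p + k) (hpp : p ^ 2 ∈ I * K) : p ∈ K := by
  -- Modulo `I * K`, the square `I * I` is generated by `p ^ 2`, so `I * I ≤ I * K`, and cancelling
  -- `I` gives `I ≤ K`.
  refine hI I _ (mul_le.2 fun u hu v hv => ?_) hp
  obtain ⟨c, k, hk, rfl⟩ := hrep u hu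
  obtain ⟨c', k', hk', rfl⟩ := hrep v hv
  have : (c * p + k) * (c' * p + k') = (c * c') * p ^ 2 + c' * (p * k) + (c * p + k) * k' := by
    ring
  rw [this]
  exact add_mem (add_mem (mul_mem_left _ _ hpp) (mul_mem_left _ _ (mul_mem_mul hp hk)))
    (mul_mem_mul hu hk')

theorem mem_span_singleton_sup_span_singleton_sup {A : Ideal R} {x y u : R} :
    u ∈ span {x} ⊔ span {y} ⊔ A ↔ ∃ α β a, a ∈ A ∧ u = α * x + β * y + a := by
  constructor
  · intro hu
    obtain ⟨v, hv, a, ha, rfl⟩ := Submodule.mem_sup.1 hu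
    obtain ⟨v', hv', w, hw, rfl⟩ := Submodule.mem_sup.1 hv
    obtain ⟨α, rfl⟩ := mem_span_singleton'.1 hv'
    obtain ⟨β, rfl⟩ := mem_span_singleton'.1 hw
    exact ⟨α, β, a, ha, rfl⟩
  · rintro ⟨α, β, a, ha, rfl⟩
    exact add_mem (Submodule.mem_sup_left (add_mem
      (Submodule.mem_sup_left (mul_mem_left _ _ (mem_span_singleton_self x)))
      (Submodule.mem_sup_right (mul_mem_left _ _ (mem_span_singleton_self y)))))
      (Submodule.mem_sup_right ha)

/-- With `J` the ideal on the right, `I²` is contained in `J + (x²)`. The missing `x²` is harmless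
after multiplying by `I`: `x·x² = x(x² + y²) - y(xy)`, `y·x² = x(xy)`, and `a·x² = a(x² + y²) -
y(ya)` for `a ∈ A`. Thus `I·I² ⊆ I·J`, and `I` cancels. -/
theorem sq_mem_of_cancel {I A : Ideal R} (hI : ∀ J N : Ideal R, I * J ≤ I * N → J ≤ N)
    {x y : R} (hx : x ∈ I) (hy : y ∈ I) (hAI : A ≤ I) (hIA : I ≤ span {x} ⊔ span {y} ⊔ A) :
    x ^ 2 ∈ span {x ^ 2 + y ^ 2} ⊔ span {x * y} ⊔ I * A := by
  have rep : ∀ u ∈ I, ∃ α β a, a ∈ A ∧ u = α * x + β * y + a := fun u hu =>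
    mem_span_singleton_sup_span_singleton_sup.1 (hIA hu)
  obtain ⟨J, hJ⟩ : ∃ J : Ideal R, J = span {x ^ 2 + y ^ 2} ⊔ span {x * y} ⊔ I * A := ⟨_, rfl⟩
  have h1 : x ^ 2 + y ^ 2 ∈ J := hJ ▸ Submodule.mem_sup_left (Submodule.mem_sup_left
    (mem_span_singleton_self _))
  have h2 : x * y ∈ J := hJ ▸ Submodule.mem_sup_left (Submodule.mem_sup_right
    (mem_span_singleton_self _))
  have h3 : ∀ u ∈ I, ∀ a ∈ A, u * a ∈ J := fun u hu a ha =>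
    hJ ▸ Submodule.mem_sup_right (mul_mem_mul hu ha)
  have hsq : I * I ≤ J ⊔ span {x ^ 2} := by
    refine mul_le.2 fun u hu v hv => ?_
    obtain ⟨α, β, a, ha, rfl⟩ := rep u hu
    obtain ⟨α', β', a', ha', rfl⟩ := rep v hv
    refine Submodule.mem_sup.2 ⟨β * β' * (x ^ 2 + y ^ 2) + (α * β' + β * α') * (x * y) +
      (α * x + β * y + a) * a' + (α' * x + β' * y) * a, ?_, (α * α' - β * β') * x ^ 2,
      mul_mem_left _ _ (mem_span_singleton_self _), by ring⟩
    exact add_mem (add_mem (add_mem (J.mul_mem_left _ h1) (J.mul_mem_left _ h2)) (h3 _ hu _ ha'))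
      (h3 _ (add_mem (I.mul_mem_left _ hx) (I.mul_mem_left _ hy)) _ ha)
  have hcube : I * (I * I) ≤ I * J := by
    refine (mul_mono_right hsq).trans ?_
    rw [Ideal.mul_sup]
    refine sup_le le_rfl (mul_le.2 fun u hu v hv => ?_)
    obtain ⟨c, rfl⟩ := mem_span_singleton'.1 hv
    obtain ⟨α, β, a, ha, rfl⟩ := rep u hu
    have : (α * x + β * y + a) * (c * x ^ 2) = c * (α * (x * (x ^ 2 + y ^ 2)) - α * (y * (x * y))
        + β * (x * (x * y)) + a * (x ^ 2 + y ^ 2) - y * (y * a)) := by ring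
    rw [this]
    exact mul_mem_left _ _ (sub_mem (add_mem (add_mem (sub_mem
      (mul_mem_left _ _ (mul_mem_mul hx h1)) (mul_mem_left _ _ (mul_mem_mul hy h2)))
      (mul_mem_left _ _ (mul_mem_mul hx h2))) (mul_mem_mul (hAI ha) h1))
      (mul_mem_mul hy (h3 _ hy _ ha)))
  rw [← hJ, sq]
  exact hI _ _ hcube (mul_mem_mul hx hx)

end Ideal

/-! ### Cancellation ideals of a local ring. -/

namespace IsLocalRing

open Ideal

variable {R : Type*} [CommRing R] [IsLocalRing R]

/-- If `x`, `y` are independent modulo `𝔪 I`, there is an ideal `A` between `𝔪 I` and `I` that is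
complementary to the span of `x` and `y` modulo `𝔪 I`. -/
theorem exists_complement_pair {I : Ideal R} {x y : R} (hx : x ∉ maximalIdeal R * I)
    (hyI : y ∈ I) (hy : y ∉ span {x} ⊔ maximalIdeal R * I) :
    ∃ A : Ideal R, maximalIdeal R * I ≤ A ∧ A ≤ I ∧ I ≤ span {x} ⊔ span {y} ⊔ A ∧
      ∀ a b : R, a * x + b * y ∈ A → a ∈ maximalIdeal R ∧ b ∈ maximalIdeal R := by
  -- The last condition says that `x` and `y` stay independent modulo `A`; a maximal such `A` is the
  -- complement.
  let S : Set (Ideal R) := {A | maximalIdeal R * I ≤ A ∧ A ≤ I ∧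
    ∀ a b : R, a * x + b * y ∈ A → a ∈ maximalIdeal R ∧ b ∈ maximalIdeal R}
  have hS : maximalIdeal R * I ∈ S := by
    refine ⟨le_rfl, mul_le_right, fun a b hab => ?_⟩
    have hb : b ∈ maximalIdeal R := by
      by_contra hb
      obtain ⟨u, rfl⟩ := notMem_maximalIdeal.1 hb
      refine hy (Submodule.mem_sup.2 ⟨-(↑u⁻¹ * a) * x, mul_mem_left _ _ (mem_span_singleton_self x),
        _, mul_mem_left _ (↑u⁻¹ : R) hab, ?_⟩)
      linear_combination y * u.inv_mul
    have ha : a * x ∈ maximalIdeal R * I := by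
      simpa using sub_mem hab (mul_mem_mul hb hyI)
    refine ⟨?_, hb⟩
    by_contra hau
    obtain ⟨u, rfl⟩ := notMem_maximalIdeal.1 hau
    exact hx (by simpa using mul_mem_left _ (↑u⁻¹ : R) ha)
  obtain ⟨A, hmA, hA⟩ := zorn_le_nonempty₀ S (fun c hcS hc B hB => by
    refine ⟨sSup c, ⟨(hcS hB).1.trans (le_sSup hB), sSup_le fun C hC => (hcS hC).2.1,
      fun a b hab => ?_⟩, fun C hC => le_sSup hC⟩
    obtain ⟨C, hC, h⟩ := (Submodule.mem_sSup_of_directed ⟨B, hB⟩ hc.directedOn).1 hab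
    exact (hcS hC).2.2 a b h) _ hS
  refine ⟨A, hA.1.1, hA.1.2.1, fun z hz => ?_, hA.1.2.2⟩
  by_contra hzn
  refine hzn (Submodule.mem_sup_right (hA.2 (y := A ⊔ span {z}) ⟨hA.1.1.trans le_sup_left,
    sup_le hA.1.2.1 ((span_singleton_le_iff_mem _).2 hz), fun a b hab => ?_⟩ le_sup_left
    (Submodule.mem_sup_right (mem_span_singleton_self z))))
  obtain ⟨α, hα, w, hw, hab⟩ := Submodule.mem_sup.1 hab
  obtain ⟨c, rfl⟩ := mem_span_singleton'.1 hw
  -- If `c` is a unit, the relation `α + c * z = a * x + b * y` puts `z` in `(x) + (y) + A`, against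
  -- the choice of `z`.
  by_cases hc : c ∈ maximalIdeal R
  · exact hA.1.2.2 a b (hab ▸ add_mem hα (hA.1.1 (mul_mem_mul hc hz)))
  · obtain ⟨u, rfl⟩ := notMem_maximalIdeal.1 hc
    refine absurd (Submodule.mem_sup.2 ⟨(↑u⁻¹ * a) * x + (↑u⁻¹ * b) * y, Submodule.mem_sup.2
      ⟨_, mul_mem_left _ _ (mem_span_singleton_self x), _,
        mul_mem_left _ _ (mem_span_singleton_self y), rfl⟩,
      -(↑u⁻¹ * α), neg_mem (A.mul_mem_left _ hα), ?_⟩) hzn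
    linear_combination (-(↑u⁻¹ : R)) * hab + z * u.inv_mul

/-- In a cancellation ideal, one of two generators modulo `A ⊇ 𝔪 I` is superfluous. -/
theorem mem_sup_or_mem_sup_of_cancel {I A : Ideal R} (hI : ∀ J N : Ideal R, I * J ≤ I * N → J ≤ N)
    {x y : R} (hx : x ∈ I) (hy : y ∈ I) (hmA : maximalIdeal R * I ≤ A) (hAI : A ≤ I)
    (hIA : I ≤ span {x} ⊔ span {y} ⊔ A) : x ∈ span {y} ⊔ A ∨ y ∈ span {x} ⊔ A := by
  have rep : ∀ u ∈ I, ∃ α β a, a ∈ A ∧ u = α * x + β * y + a := fun u hu =>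
    mem_span_singleton_sup_span_singleton_sup.1 (hIA hu)
  obtain ⟨l, μ, b, hb, hxx⟩ := mem_span_singleton_sup_span_singleton_sup.1
    (sq_mem_of_cancel hI hx hy hAI hIA)
  have hbK : ∀ q, b ∈ I * (span {q} ⊔ A) := fun q => mul_mono_right le_sup_right hb
  have hself : ∀ q : R, q ∈ span {q} ⊔ A := fun q =>
    Submodule.mem_sup_left (mem_span_singleton_self q)
  -- In `x² = l(x² + y²) + μxy + b`: if `l ∈ 𝔪`, then `lx ∈ A` and `x² ∈ I((y) + A)`; if `l` is a
  -- unit, solving for `y²` gives `y² ∈ I((x) + A)`.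
  by_cases hl : l ∈ maximalIdeal R
  · refine Or.inl (mem_of_sq_mem_mul hI hx (fun u hu => ?_) ?_)
    · obtain ⟨α, β, a, ha, rfl⟩ := rep u hu
      exact ⟨α, β * y + a, add_mem (mul_mem_left _ _ (hself y)) (Submodule.mem_sup_right ha),
        by ring⟩
    · have : x ^ 2 = x * (l * x) + l * (y * y) + μ * (x * y) + b := by
        linear_combination hxx
      rw [this]
      exact add_mem (add_mem (add_mem
        (mul_mem_mul hx (Submodule.mem_sup_right (hmA (mul_mem_mul hl hx))))
        (mul_mem_left _ _ (mul_mem_mul hy (hself y))))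
        (mul_mem_left _ _ (mul_mem_mul hx (hself y)))) (hbK y)
  · obtain ⟨u, rfl⟩ := notMem_maximalIdeal.1 hl
    refine Or.inr (mem_of_sq_mem_mul hI hy (fun u hu => ?_) ?_)
    · obtain ⟨α, β, a, ha, rfl⟩ := rep u hu
      exact ⟨β, α * x + a, add_mem (mul_mem_left _ _ (hself x)) (Submodule.mem_sup_right ha),
        by ring⟩
    · have : y ^ 2 = (↑u⁻¹ * (1 - u)) * (x * x) - (↑u⁻¹ * μ) * (y * x) - ↑u⁻¹ * b := by
        linear_combination (-(↑u⁻¹ : R)) * hxx - y ^ 2 * u.inv_mul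
      rw [this]
      exact sub_mem (sub_mem (mul_mem_left _ _ (mul_mem_mul hx (hself x)))
        (mul_mem_left _ _ (mul_mem_mul hy (hself x)))) (mul_mem_left _ _ (hbK x))

/-- A cancellation ideal of a local ring is principal. -/
theorem isPrincipal_of_cancel {I : Ideal R} (hI : ∀ J N : Ideal R, I * J ≤ I * N → J ≤ N) :
    I.IsPrincipal := by
  -- Otherwise `I·R ⊆ I·𝔪`, and cancelling `I` gives `R ⊆ 𝔪`.
  have hne : ¬ I ≤ maximalIdeal R * I := fun h =>
    (maximalIdeal.isMaximal R).ne_top (top_le_iff.1 (hI _ _ (by rwa [mul_top, mul_comm I])))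
  obtain ⟨x, hxI, hx⟩ := SetLike.not_le_iff_exists.1 hne
  have hgen : I ≤ span {x} ⊔ maximalIdeal R * I := by
    intro y hyI
    by_contra hy
    obtain ⟨A, hmA, hAI, hIA, hind⟩ := exists_complement_pair hx hyI hy
    rcases mem_sup_or_mem_sup_of_cancel hI hxI hyI hmA hAI hIA with h | h <;>
      obtain ⟨v, hv, a, ha, h⟩ := Submodule.mem_sup.1 h <;>
      obtain ⟨c, rfl⟩ := mem_span_singleton'.1 hv
    · refine (ne_top_iff_one _).1 (maximalIdeal.isMaximal R).ne_top (hind 1 (-c) ?_).1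
      rwa [show 1 * x + -c * y = a by linear_combination -h]
    · refine (ne_top_iff_one _).1 (maximalIdeal.isMaximal R).ne_top (hind (-c) 1 ?_).2
      rwa [show -c * x + 1 * y = a by linear_combination -h]
  refine ⟨x, le_antisymm (fun b hb => ?_) ((span_singleton_le_iff_mem _).2 hxI)⟩
  -- Nakayama's lemma is unavailable, as `I` need not be known to be finitely generated. Instead `I
  -- = (x) + 𝔪I` is multiplied by `b`; since `xb ∈ I·(x)`, cancelling `I` leaves `b ∈ (x) + 𝔪b`,
  -- where `1 - m` is invertible for `m ∈ 𝔪`.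
  have hle : I * span {b} ≤ I * (span {x} ⊔ maximalIdeal R * span {b}) := by
    calc I * span {b} ≤ (span {x} ⊔ maximalIdeal R * I) * span {b} := mul_mono_left hgen
      _ = span {x} * span {b} ⊔ I * (maximalIdeal R * span {b}) := by
        rw [Ideal.sup_mul, mul_comm (maximalIdeal R) I, mul_assoc]
      _ ≤ I * span {x} ⊔ I * (maximalIdeal R * span {b}) := by
        rw [mul_comm (span {x})]
        exact sup_le_sup_right (mul_mono_left ((span_singleton_le_iff_mem _).2 hb)) _
      _ = _ := (Ideal.mul_sup _ _ _).symm
  obtain ⟨v, hv, w, hw, h⟩ := Submodule.mem_sup.1 (hI _ _ hle (mem_span_singleton_self b))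
  obtain ⟨m, hm, rfl⟩ := mem_mul_span_singleton.1 hw
  obtain ⟨u, hu⟩ := isUnit_one_sub_self_of_mem_nonunits m ((mem_maximalIdeal m).1 hm)
  have : b = ↑u⁻¹ * v := by
    linear_combination (-(↑u⁻¹ : R)) * h - b * u.inv_mul + (↑u⁻¹ : R) * b * hu
  rw [this]
  exact mul_mem_left _ _ hv

end IsLocalRing

/-! ### Closures, maximal `W`-ideals and localization. -/

namespace StarIdeal

open Ideal

section Closure

variable {D : Type*} [CommRing D] {W : Submonoid (Ideal D)}

theorem idealClosure_mono {I J : Ideal D} (h : I ≤ J) : idealClosure W I ≤ idealClosure W J :=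
  fun _ hx => by
    obtain ⟨H, hH, hx⟩ := mem_idealClosure.1 hx
    exact mem_idealClosure.2 ⟨H, hH, fun z hz => h (hx z hz)⟩

/-- This is where finite generation gives finite character: `H * (x)` is finitely generated, so it
already lies in one member of the directed family, and that member is closed. It supplies the upper
bounds for Zorn's lemma. -/
theorem idealClosure_sSup_le (hW : ∀ H ∈ W, H.FG) {c : Set (Ideal D)} (hne : c.Nonempty)
    (hc : DirectedOn (· ≤ ·) c) (hcl : ∀ I ∈ c, IsClosedIdeal W I) :
    idealClosure W (sSup c) ≤ sSup c := by
  intro x hx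
  obtain ⟨H, hH, hx⟩ := mem_idealClosure.1 hx
  have hle : H * span {x} ≤ sSup c := mul_le.2 fun h hh z hz => by
    obtain ⟨a, rfl⟩ := mem_span_singleton'.1 hz
    rw [show h * (a * x) = a * (x * h) by ring]
    exact mul_mem_left _ _ (hx h hh)
  obtain ⟨I, hI, hHI⟩ := (CompleteLattice.isCompactElement_iff_le_of_directed_sSup_le _ _).1
    ((Submodule.fg_iff_compact _).1 ((hW H hH).mul (Submodule.fg_span_singleton x))) c hne hc hle
  refine le_sSup hI ?_
  rw [hcl I hI]
  refine mem_idealClosure.2 ⟨H, hH, fun h hh => ?_⟩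
  rw [mul_comm]
  exact hHI (mul_mem_mul hh (mem_span_singleton_self x))

theorem exists_le_isMaximalClosedIdeal (hW : ∀ H ∈ W, H.FG) {I : Ideal D}
    (hI : IsClosedIdeal W I) (hne : I ≠ ⊤) : ∃ M, IsMaximalClosedIdeal W M ∧ I ≤ M := by
  obtain ⟨M, hIM, hM⟩ := zorn_le_nonempty₀ {I : Ideal D | IsClosedIdeal W I ∧ I ≠ ⊤}
    (fun c hcS hc J hJ => by
      refine ⟨sSup c, ⟨le_antisymm (le_idealClosure _ _) (idealClosure_sSup_le hW ⟨J, hJ⟩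
        hc.directedOn fun I hI => (hcS hI).1), fun htop => ?_⟩, fun C hC => le_sSup hC⟩
      obtain ⟨C, hC, h⟩ := (Submodule.mem_sSup_of_directed ⟨J, hJ⟩ hc.directedOn).1
        ((eq_top_iff_one _).1 htop)
      exact (hcS hC).2 ((eq_top_iff_one _).2 h)) I ⟨hI, hne⟩
  exact ⟨M, hM, hIM⟩

/-- The closure of `J` is the intersection of its localizations at the maximal `W`-ideals. -/
theorem mem_idealClosure_iff_forall_maximal (hW : ∀ H ∈ W, H.FG) {J : Ideal D} {x : D} :
    x ∈ idealClosure W J ↔ ∀ M, IsMaximalClosedIdeal W M → ∃ t ∉ M, t * x ∈ J := by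
  constructor
  · intro hx M hM
    obtain ⟨H, hH, hx⟩ := mem_idealClosure.1 hx
    -- A member of `W` inside `M` would put `1` in `M_W = M`.
    have hHM : ¬ H ≤ M := fun hle => hM.1.2 ((eq_top_iff_one _).2 (by
      rw [hM.1.1]
      exact mem_idealClosure.2 ⟨H, hH, fun h hh => by simpa using hle hh⟩))
    obtain ⟨t, htH, htM⟩ := SetLike.not_le_iff_exists.1 hHM
    exact ⟨t, htM, mul_comm x t ▸ hx t htH⟩
  · intro h
    -- The hypothesis says that `(J : x)` lies in no maximal `W`-ideal, so its closure is
    -- everything; hence some `H ∈ W` lies in `(J : x)`.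
    have htop : idealClosure W (J.colon {x}) = ⊤ := by
      by_contra hne
      obtain ⟨M, hM, hle⟩ := exists_le_isMaximalClosedIdeal hW
        (idealClosure_idealClosure hW (J.colon {x})).symm hne
      obtain ⟨t, htM, ht⟩ := h M hM
      exact htM (hle (le_idealClosure _ _ (Submodule.mem_colon_singleton.2 ht)))
    obtain ⟨H, hH, h1⟩ := mem_idealClosure.1 ((eq_top_iff_one _).1 htop)
    refine mem_idealClosure.2 ⟨H, hH, fun z hz => ?_⟩
    have := Submodule.mem_colon_singleton.1 (h1 z hz)
    rwa [one_mul, smul_eq_mul, mul_comm] at this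

/-- The inclusion form follows by cancelling `Q` from `Q(J + N)` and `QN`, which have the same
closure. -/
theorem IsCancellationIdeal.le_of_mul_le {Q : Ideal D} (hW : ∀ H ∈ W, H.FG)
    (hQ : IsCancellationIdeal W Q) {J N : Ideal D} (h : Q * J ≤ idealClosure W (Q * N)) :
    J ≤ idealClosure W N := by
  have key := hQ.2 (J ⊔ N) N (le_antisymm ?_ (idealClosure_mono (mul_mono_right le_sup_right)))
  · exact le_sup_left.trans ((le_idealClosure W _).trans key.le)
  · rw [← idealClosure_idealClosure hW (Q * N), Ideal.mul_sup]
    exact idealClosure_mono (sup_le h (le_idealClosure _ _))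

/-- The localization of a `W`-cancellation ideal at a maximal `W`-ideal is a cancellation ideal. -/
theorem IsCancellationIdeal.localization_cancel {Q : Ideal D} (hW : ∀ H ∈ W, H.FG)
    (hQ : IsCancellationIdeal W Q) {M : Ideal D} [M.IsPrime] (hM : IsMaximalClosedIdeal W M)
    (J N : Ideal (Localization.AtPrime M))
    (h : Q.map (algebraMap D _) * J ≤ Q.map (algebraMap D _) * N) : J ≤ N := by
  intro z hz
  obtain ⟨x, s, rfl⟩ := IsLocalization.exists_mk'_eq M.primeCompl z
  have hxJ : algebraMap D (Localization.AtPrime M) x ∈ J := by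
    rw [← IsLocalization.mk'_spec (Localization.AtPrime M) x s]
    exact J.mul_mem_right _ hz
  rw [IsLocalization.mk'_mem_iff]
  have hNN : (N.comap (algebraMap D _)).map (algebraMap D (Localization.AtPrime M)) = N :=
    IsLocalization.map_under M.primeCompl _ N
  -- The summand `xM` makes the inclusion automatic at maximal `W`-ideals other than `M`, since they
  -- do not contain `M`; at `M` the contraction of `N` suffices by `h`. After cancellation the
  -- summand is absorbed at `M`, because `t - m` is a unit there for `t ∉ M` and `m ∈ M`.
  have hle : Q * span {x} ≤
      idealClosure W (Q * (N.comap (algebraMap D (Localization.AtPrime M)) ⊔ span {x} * M)) := by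
    refine mul_le.2 fun q hq w hw => ?_
    obtain ⟨c, rfl⟩ := mem_span_singleton'.1 hw
    rw [show q * (c * x) = c * (q * x) by ring]
    refine mul_mem_left _ _ ((mem_idealClosure_iff_forall_maximal hW).2 fun M' hM' => ?_)
    by_cases hMM : M ≤ M'
    · have hM'M : M' ≤ M := hM.2 hM'.1 hMM
      have hmem : algebraMap D (Localization.AtPrime M) (q * x) ∈
          (Q * N.comap (algebraMap D _)).map (algebraMap D (Localization.AtPrime M)) := by
        rw [map_mul, Ideal.map_mul, hNN]
        exact h (mul_mem_mul (mem_map_of_mem _ hq) hxJ)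
      obtain ⟨t, ht, htq⟩ :=
        (IsLocalization.algebraMap_mem_map_algebraMap_iff M.primeCompl _ _ _).1 hmem
      exact ⟨t, fun h' => ht (hM'M h'), mul_mono_right le_sup_left htq⟩
    · obtain ⟨t, htM, htM'⟩ := SetLike.not_le_iff_exists.1 hMM
      refine ⟨t, htM', ?_⟩
      rw [show t * (q * x) = q * (x * t) by ring]
      exact mul_mem_mul hq (Submodule.mem_sup_right
        (mul_mem_mul (mem_span_singleton_self x) htM))
  obtain ⟨t, htM, ht⟩ := (mem_idealClosure_iff_forall_maximal hW).1
    (hQ.le_of_mul_le hW hle (mem_span_singleton_self x)) M hM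
  obtain ⟨n, hn, w, hw, htx⟩ := Submodule.mem_sup.1 ht
  obtain ⟨m, hm, rfl⟩ := mem_span_singleton_mul.1 hw
  have hu : IsUnit (algebraMap D (Localization.AtPrime M) (t - m)) :=
    IsLocalization.map_units _ (⟨t - m, fun h' => htM (by simpa using add_mem h' hm)⟩ :
      M.primeCompl)
  rw [← Ideal.unit_mul_mem_iff_mem N hu, ← map_mul]
  rwa [show (t - m) * x = n by linear_combination -htx]

theorem map_idealClosure (hW : ∀ H ∈ W, H.FG) {M : Ideal D} [M.IsPrime]
    (hM : IsMaximalClosedIdeal W M) (J : Ideal D) :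
    (idealClosure W J).map (algebraMap D (Localization.AtPrime M)) =
      J.map (algebraMap D (Localization.AtPrime M)) := by
  refine le_antisymm (map_le_iff_le_comap.2 fun x hx => ?_) (map_mono (le_idealClosure _ _))
  obtain ⟨t, ht, htx⟩ := (mem_idealClosure_iff_forall_maximal hW).1 hx M hM
  exact (IsLocalization.algebraMap_mem_map_algebraMap_iff M.primeCompl _ _ _).2 ⟨t, ht, htx⟩

/-- A nonzero `W`-ideal of a domain is a `W`-cancellation ideal if and only if its localizations
at the maximal `W`-ideals are principal. -/
theorem isCancellationIdeal_iff [IsDomain D] (hW : ∀ H ∈ W, H.FG) {Q : Ideal D} (hQ0 : Q ≠ ⊥)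
    (hQ : IsClosedIdeal W Q) :
    IsCancellationIdeal W Q ↔ ∀ (M : Ideal D) (hM : IsMaximalClosedIdeal W M),
      haveI : M.IsPrime := hM.isPrime hW
      (Q.map (algebraMap D (Localization.AtPrime M))).IsPrincipal := by
  constructor
  · intro hc M hM
    have : M.IsPrime := hM.isPrime hW
    exact IsLocalRing.isPrincipal_of_cancel (hc.localization_cancel hW hM)
  · refine fun hp => ⟨hQ, ?_⟩
    have key : ∀ J N : Ideal D, idealClosure W (Q * J) = idealClosure W (Q * N) →
        idealClosure W J ≤ idealClosure W N := by
      intro J N h x hx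
      refine (mem_idealClosure_iff_forall_maximal hW).2 fun M hM => ?_
      have : M.IsPrime := hM.isPrime hW
      obtain ⟨q, hq⟩ := hp M hM
      have hinj : Function.Injective (algebraMap D (Localization.AtPrime M)) :=
        IsLocalization.injective _ M.primeCompl_le_nonZeroDivisors
      -- Cancelling the local generator `q` needs `q ≠ 0`, which comes from `Q ≠ ⊥` and the
      -- injectivity of `D → D_M`.
      have hq0 : q ≠ 0 := by
        rintro rfl
        rw [Submodule.span_singleton_eq_bot.2 rfl] at hq
        exact hQ0 ((map_eq_bot_iff_of_injective hinj).1 hq)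
      have h1 := congrArg (Ideal.map (algebraMap D (Localization.AtPrime M))) h
      rw [map_idealClosure hW hM, map_idealClosure hW hM, Ideal.map_mul, Ideal.map_mul, hq] at h1
      have h2 := (span_singleton_mul_right_inj hq0).1 h1
      have h3 := mem_map_of_mem (algebraMap D (Localization.AtPrime M)) hx
      rw [map_idealClosure hW hM, h2] at h3
      exact (IsLocalization.algebraMap_mem_map_algebraMap_iff M.primeCompl _ _ _).1 h3
    exact fun J N h => le_antisymm (key J N h) (key N J h.symm)

end Closure

end StarIdeal

theorem corollary16 {D K : Type*} [CommRing D] [IsDomain D] [Field K] [Algebra D K]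
    [IsFractionRing D K] :
    (∀ Q : Ideal D, Q ≠ ⊥ → StarIdeal.IsClosedIdeal (StarIdeal.wFamily D K) Q →
      (StarIdeal.IsCancellationIdeal (StarIdeal.wFamily D K) Q ↔
        ∀ (M : Ideal D) (hM : StarIdeal.IsMaximalClosedIdeal (StarIdeal.wFamily D K) M),
          haveI : M.IsPrime := hM.isPrime StarIdeal.fg_of_mem_wFamily
          (Q.map (algebraMap D (Localization.AtPrime M))).IsPrincipal)) ∧
    (∀ (s : StarIdeal.StarOperation D K) (Q : Ideal D), Q ≠ ⊥ →
      StarIdeal.IsClosedIdeal s.wFamily Q →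
      (StarIdeal.IsCancellationIdeal s.wFamily Q ↔
        ∀ (M : Ideal D) (hM : StarIdeal.IsMaximalClosedIdeal s.wFamily M),
          haveI : M.IsPrime := hM.isPrime s.fg_of_mem_wFamily
          (Q.map (algebraMap D (Localization.AtPrime M))).IsPrincipal)) := by
  exact ⟨fun _ hQ0 hQ => StarIdeal.isCancellationIdeal_iff StarIdeal.fg_of_mem_wFamily hQ0 hQ,
    fun s _ hQ0 hQ => StarIdeal.isCancellationIdeal_iff s.fg_of_mem_wFamily hQ0 hQ⟩
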